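/- For every integer $n\ge 1$ let $s(n)$ be the number of subgroups of $\mathbb{Z}_n\times\mathbb{Z}_n$ and let $A(n)$ be the arithmetic mean of the exponents of these subgroups. Then $A(n)=\sigma(n)^2/s(n)$ for every $n\ge 1$, where $\sigma(n)=\sum_{d\mid n}d$. Let $$M:=\prod_p\left(1-\frac1p\right)\sum_{\nu=0}^{\infty}\frac{(p^{\nu+1}-1)^2}{p^{2\nu}\left(p^{\nu+2}+p^{\nu+1}-(2\nu+3)p+2\nu+1\right)},$$ the product being over the primes. The series and the product converge (the product unconditionally), $M$ is the mean value of $A(n)/n$, that is, $$M=\lim_{x\to\infty}\frac1x\sum_{n\le x}\frac{A(n)}{n},$$ and, as $x\to\infty$ over the reals, $$\sum_{n\le x}A(n)=\frac M2\,x^2+O\left(x\log^3x\right).$$ -/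

import Mathlib

open Filter Topology Asymptotics

noncomputable section

/-- `s(n)`: the number of subgroups of `Z_n × Z_n`. -/
def subgroupCount (n : ℕ) : ℕ :=
  Nat.card (AddSubgroup (ZMod n × ZMod n))

/-- `A(n)`: the arithmetic mean of the exponents of the subgroups of `Z_n × Z_n`
(for `n ≥ 1` there are finitely many subgroups, and each has a positive exponent). -/
def meanExponent (n : ℕ) : ℝ :=
  (∑ᶠ H : AddSubgroup (ZMod n × ZMod n), (AddMonoid.exponent H : ℝ)) / (subgroupCount n : ℝ)

/-- The `ν`-th term of the local series at `p`. -/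
def eulerTerm (p ν : ℕ) : ℝ :=
  ((p : ℝ) ^ (ν + 1) - 1) ^ 2 /
    ((p : ℝ) ^ (2 * ν) *
      ((p : ℝ) ^ (ν + 2) + (p : ℝ) ^ (ν + 1) - (2 * (ν : ℝ) + 3) * (p : ℝ) + 2 * (ν : ℝ) + 1))

/-- The Euler factor at `p`. -/
def eulerFactor (p : ℕ) : ℝ :=
  (1 - 1 / (p : ℝ)) * ∑' ν : ℕ, eulerTerm p ν

/-- The constant `M`, as a product over the primes. -/
def meanConstant : ℝ :=
  ∏' p : Nat.Primes, eulerFactor (p : ℕ)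

end

/-!
Subgroups of `G × H` correspond to triples of a projection `P ≤ G`, a kernel `K ≤ H` and a
homomorphism `P → H ⧸ K` (`subgroupOfHom_bijective`). For `G = H = ℤ_n` everything is cyclic, so
`s(n) = ∑ gcd (a, b)` over pairs of divisors of `n` (`subgroupCount_eq_sum_gcd`), whence `s = φ * τ²`
is multiplicative. The subgroups of exponent `e ∣ n` live in the `e`-torsion, a copy of `ℤ_e × ℤ_e`,
so if `c(e)` counts those of exponent `e` in `ℤ_e × ℤ_e`, then `s = 1 * c` and the sum of the
exponents is `1 * (id · c)`. Both this and `σ²` are multiplicative, and on prime powers they agree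
(`zeta_mul_pmul_fullExponentFun`), which gives `A = σ² / s`.

Write `A = id * g`. By the closed form of `A(p ^ k)`, it lies above `p ^ (k + 1) / (p + 1)` by at most
`(k + 2) (k + 3) / (2 p)` (`meanExponentFun_prime_pow_sub`), so that
`|g(p ^ k)| ≤ (k + 1) (k + 2) / 2 = d₃(p ^ k)`, where `d₃ = 1 * 1 * 1`; by multiplicativity
`|g| ≤ d₃` everywhere (`abs_correctionFun_le`). In particular
`∑ |g(d)| / d ^ β ≤ ζ(β) ^ 3 ≤ (1 + 1 / (β - 1)) ^ 3` for `β > 1`, and `M = ∑ g(d) / d ^ 2` by its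
Euler product (`meanConstant_eq`).

The asymptotics need no truncation of the sum over `d`. For `1 ≤ β ≤ 2` the estimate
`|∑_{m ≤ y} m - y ^ 2 / 2| ≤ y ^ β` holds for all `y > 0`, so `abs_sum_mul_sub_le` bounds the error by
`x ^ β ∑ |g(d)| / d ^ β ≤ x ^ β (1 + 1 / (β - 1)) ^ 3`, and `β = 1 + 1 / log x` makes this
`O(x log ^ 3 x)`. The mean value of `A(n) / n` follows in the same way from
`|⌊y⌋ - y| ≤ y ^ (1 / 2)`.
-/

/-! ### Subgroups of a product -/

section Goursat

variable {G H : Type*} [AddCommGroup G] [AddCommGroup H]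

/-- The subgroup of `G × H` attached to subgroups `P ≤ G`, `K ≤ H` and a homomorphism
`f : P → H ⧸ K`: the pairs `(x, y)` with `x ∈ P` and `f x = y + K`. -/
def subgroupOfHom (P : AddSubgroup G) (K : AddSubgroup H) (f : P →+ H ⧸ K) :
    AddSubgroup (G × H) where
  carrier := {z | ∃ h : z.1 ∈ P, f ⟨z.1, h⟩ = (z.2 : H ⧸ K)}
  zero_mem' := ⟨P.zero_mem, map_zero f⟩
  add_mem' := by
    rintro x y ⟨hx, ex⟩ ⟨hy, ey⟩
    refine ⟨P.add_mem hx hy, ?_⟩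
    have := map_add f ⟨x.1, hx⟩ ⟨y.1, hy⟩
    rw [ex, ey] at this
    exact this
  neg_mem' := by
    rintro x ⟨hx, ex⟩
    refine ⟨P.neg_mem hx, ?_⟩
    have := map_neg f ⟨x.1, hx⟩
    rw [ex] at this
    exact this

lemma mem_subgroupOfHom {P : AddSubgroup G} {K : AddSubgroup H} {f : P →+ H ⧸ K} {z : G × H} :
    z ∈ subgroupOfHom P K f ↔ ∃ h : z.1 ∈ P, f ⟨z.1, h⟩ = (z.2 : H ⧸ K) := Iff.rfl

lemma map_fst_subgroupOfHom (P : AddSubgroup G) (K : AddSubgroup H) (f : P →+ H ⧸ K) :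
    (subgroupOfHom P K f).map (AddMonoidHom.fst G H) = P := by
  ext x
  constructor
  · rintro ⟨z, ⟨h, -⟩, rfl⟩
    exact h
  · intro hx
    obtain ⟨y, hy⟩ := QuotientAddGroup.mk_surjective (f ⟨x, hx⟩)
    exact ⟨(x, y), ⟨hx, hy.symm⟩, rfl⟩

lemma comap_inr_subgroupOfHom (P : AddSubgroup G) (K : AddSubgroup H) (f : P →+ H ⧸ K) :
    (subgroupOfHom P K f).comap (AddMonoidHom.inr G H) = K := by
  ext y
  rw [AddSubgroup.mem_comap, mem_subgroupOfHom]
  have h0 : f ⟨0, P.zero_mem⟩ = 0 := map_zero f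
  constructor
  · rintro ⟨h, e⟩
    have e' : (0 : H ⧸ K) = (y : H ⧸ K) := h0.symm.trans e
    exact (QuotientAddGroup.eq_zero_iff y).1 e'.symm
  · intro hy
    exact ⟨P.zero_mem, h0.trans ((QuotientAddGroup.eq_zero_iff y).2 hy).symm⟩

/-- Every subgroup of `G × H` arises exactly once as `subgroupOfHom P K f`. -/
lemma subgroupOfHom_bijective :
    Function.Bijective (fun t : (Σ P : AddSubgroup G, Σ K : AddSubgroup H, P →+ H ⧸ K) =>
      subgroupOfHom t.1 t.2.1 t.2.2) := by
  constructor
  · rintro ⟨P, K, f⟩ ⟨P', K', f'⟩ h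
    dsimp only at h
    obtain rfl : P = P' := by
      rw [← map_fst_subgroupOfHom P K f, h, map_fst_subgroupOfHom]
    obtain rfl : K = K' := by
      rw [← comap_inr_subgroupOfHom P K f, h, comap_inr_subgroupOfHom]
    congr 2
    ext ⟨x, hx⟩
    obtain ⟨y, hy⟩ := QuotientAddGroup.mk_surjective (f ⟨x, hx⟩)
    have : (x, y) ∈ subgroupOfHom P K f' := h ▸ ⟨hx, hy.symm⟩
    obtain ⟨_, e⟩ := this
    exact hy.symm.trans e.symm
  · intro L
    set P := L.map (AddMonoidHom.fst G H) with hP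
    set K := L.comap (AddMonoidHom.inr G H) with hK
    have ex : ∀ x : P, ∃ y : H, ((x : G), y) ∈ L := by
      rintro ⟨_, ⟨⟨a, b⟩, hz, rfl⟩⟩
      exact ⟨b, hz⟩
    choose s hs using ex
    -- two lifts of the same first coordinate differ by an element of `K`
    have key : ∀ (x : G) (y y' : H), (x, y) ∈ L → (x, y') ∈ L → (y : H ⧸ K) = y' := by
      intro x y y' h h'
      rw [QuotientAddGroup.eq]
      have := L.add_mem (L.neg_mem h) h'
      simpa [hK, AddSubgroup.mem_comap] using this
    let f : P →+ H ⧸ K := AddMonoidHom.mk' (fun x => (s x : H ⧸ K)) (by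
      intro a b
      exact key (a + b) _ (s a + s b) (hs (a + b)) (L.add_mem (hs a) (hs b)))
    refine ⟨⟨P, K, f⟩, ?_⟩
    ext ⟨x, y⟩
    change (x, y) ∈ subgroupOfHom P K f ↔ _
    rw [mem_subgroupOfHom]
    constructor
    · rintro ⟨h, e⟩
      have e' : (s ⟨x, h⟩ : H ⧸ K) = y := e
      rw [QuotientAddGroup.eq] at e'
      have := L.add_mem (hs ⟨x, h⟩) (show ((0 : G), -s ⟨x, h⟩ + y) ∈ L from e')
      simpa using this
    · intro h
      have hx : x ∈ P := ⟨(x, y), h, rfl⟩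
      exact ⟨hx, key x _ _ (hs ⟨x, hx⟩) h⟩

end Goursat

/-! ### Counting the subgroups of `ZMod n × ZMod n` -/

section Cyclic

/-- The kernel of multiplication by `d` on `ZMod n`. -/
def zmodTorsion (n d : ℕ) : AddSubgroup (ZMod n) :=
  (nsmulAddMonoidHom d : ZMod n →+ ZMod n).ker

lemma card_zmodTorsion {n d : ℕ} [NeZero n] (hd : d ∣ n) : Nat.card (zmodTorsion n d) = d := by
  rw [zmodTorsion, IsAddCyclic.card_nsmulAddMonoidHom_ker, Nat.card_zmod, Nat.gcd_eq_right hd]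

/-- A subgroup of order `d` consists of elements killed by `d`, and there are only `d` of those. -/
lemma eq_zmodTorsion_card {n : ℕ} [NeZero n] (K : AddSubgroup (ZMod n)) :
    K = zmodTorsion n (Nat.card K) := by
  have hdvd : Nat.card K ∣ n := by simpa using K.card_addSubgroup_dvd_card
  refine AddSubgroup.eq_of_le_of_card_ge (fun x hx => ?_) (card_zmodTorsion hdvd).le
  have := card_nsmul_eq_zero' (x := (⟨x, hx⟩ : K))
  exact congrArg Subtype.val this

lemma sum_addSubgroup_zmod {M : Type*} [AddCommMonoid M] (n : ℕ) [NeZero n]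
    [Fintype (AddSubgroup (ZMod n))] (F : ℕ → M) :
    ∑ K : AddSubgroup (ZMod n), F (Nat.card K) = ∑ d ∈ n.divisors, F d := by
  refine Finset.sum_bij' (fun K _ => Nat.card K) (fun d _ => zmodTorsion n d) ?_ ?_ ?_ ?_ ?_
  · intro K _
    exact Nat.mem_divisors.2 ⟨by simpa using K.card_addSubgroup_dvd_card, NeZero.ne n⟩
  · intros; exact Finset.mem_univ _
  · intro K _; exact (eq_zmodTorsion_card K).symm
  · intro d hd; exact card_zmodTorsion (Nat.dvd_of_mem_divisors hd)
  · intros; rfl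

lemma card_addMonoidHom_of_isAddCyclic (P Q : Type*) [AddCommGroup P] [AddCommGroup Q]
    [IsAddCyclic P] [IsAddCyclic Q] [Finite Q] :
    Nat.card (P →+ Q) = (Nat.card Q).gcd (Nat.card P) := by
  rw [← IsAddCyclic.card_nsmulAddMonoidHom_ker]
  -- homomorphisms from `ZMod a` are the elements killed by `a`
  refine Nat.card_congr
    ((zmodAddCyclicAddEquiv (G := P) inferInstance).symm.addMonoidHomCongrLeftEquiv.trans
    ((ZMod.lift _).symm.trans ?_))
  refine (Equiv.subtypeEquiv (zmultiplesHom Q).symm fun f => ?_)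
  change _ ↔ Nat.card P • f 1 = 0
  rw [← map_nsmul]
  simp

end Cyclic

/-- A subgroup of `ℤ_n × ℤ_n` amounts to a projection of order `a`, a kernel of order `b`, and one
of the `gcd (n / b, a)` homomorphisms from the former to the quotient by the latter. -/
lemma subgroupCount_eq_sum_gcd (n : ℕ) [NeZero n] :
    subgroupCount n = ∑ a ∈ n.divisors, ∑ b ∈ n.divisors, a.gcd b := by
  classical
  have : Fintype (AddSubgroup (ZMod n)) := Fintype.ofFinite _
  have hfin (P K : AddSubgroup (ZMod n)) : Finite (P →+ ZMod n ⧸ K) := DFunLike.finite _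
  rw [subgroupCount, ← Nat.card_congr (Equiv.ofBijective _ subgroupOfHom_bijective), Nat.card_sigma]
  rw [← sum_addSubgroup_zmod n (fun a => ∑ b ∈ n.divisors, a.gcd b)]
  refine Finset.sum_congr rfl fun P _ => ?_
  rw [Nat.card_sigma]
  rw [← Nat.sum_div_divisors n (fun b => (Nat.card P).gcd b),
    ← sum_addSubgroup_zmod n (fun b => (Nat.card P).gcd (n / b))]
  refine Finset.sum_congr rfl fun K _ => ?_
  have : IsAddCyclic (ZMod n ⧸ K) :=
    isAddCyclic_of_surjective (QuotientAddGroup.mk' K) (QuotientAddGroup.mk'_surjective K)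
  rw [card_addMonoidHom_of_isAddCyclic, Nat.gcd_comm]
  congr 1
  have := K.card_eq_card_quotient_mul_card_addSubgroup
  rw [Nat.card_zmod] at this
  exact (Nat.div_eq_of_eq_mul_left Nat.card_pos this).symm

/-! ### Subgroups of a given exponent -/

/-- The number of subgroups of `ℤ_e × ℤ_e` of exponent `e`. -/
noncomputable def fullExponentCount (e : ℕ) : ℕ :=
  Nat.card {H : AddSubgroup (ZMod e × ZMod e) // AddMonoid.exponent H = e}

/-- For `e ∣ n`, the subgroups of exponent `e` of `ℤ_n × ℤ_n` lie in the `e`-torsion, which is a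
copy of `ℤ_e × ℤ_e`. Hence their number does not depend on `n`. -/
lemma card_exponent_eq {n e : ℕ} [NeZero n] (he : e ∣ n) :
    Nat.card {H : AddSubgroup (ZMod n × ZMod n) // AddMonoid.exponent H = e}
      = fullExponentCount e := by
  have hcard : Nat.card (ZMod e) = Nat.card (zmodTorsion n e) := by
    rw [card_zmodTorsion he, Nat.card_zmod]
  let j : ZMod e →+ ZMod n :=
    (zmodTorsion n e).subtype.comp (addEquivOfAddCyclicCardEq hcard).toAddMonoidHom
  have hj : Function.Injective j :=
    Subtype.val_injective.comp (addEquivOfAddCyclicCardEq hcard).injective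
  have hjr : ∀ x : ZMod n, e • x = 0 → ∃ y, j y = x := fun x hx =>
    ⟨(addEquivOfAddCyclicCardEq hcard).symm ⟨x, hx⟩, by simp [j]⟩
  let i : ZMod e × ZMod e →+ ZMod n × ZMod n := j.prodMap j
  have hi : Function.Injective i := hj.prodMap hj
  have hexp : ∀ H : AddSubgroup (ZMod e × ZMod e),
      AddMonoid.exponent (H.map i) = AddMonoid.exponent H := fun H =>
    (AddMonoid.exponent_eq_of_addEquiv (H.equivMapOfInjective i hi)).symm
  symm
  refine Nat.card_congr (Equiv.ofBijective
    (fun H => ⟨H.1.map i, (hexp H.1).trans H.2⟩) ⟨?_, ?_⟩)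
  · intro H H' h
    exact Subtype.ext (AddSubgroup.map_injective hi (Subtype.ext_iff.1 h))
  · rintro ⟨L, hL⟩
    have hle : L ≤ i.range := by
      intro z hz
      have h0 : e • (⟨z, hz⟩ : L) = 0 := hL ▸ AddMonoid.exponent_nsmul_eq_zero _
      have h1 : e • z = 0 := congrArg Subtype.val h0
      obtain ⟨y₁, h₁⟩ := hjr z.1 (congrArg Prod.fst h1)
      obtain ⟨y₂, h₂⟩ := hjr z.2 (congrArg Prod.snd h1)
      exact ⟨(y₁, y₂), Prod.ext h₁ h₂⟩
    have hm : (L.comap i).map i = L := AddSubgroup.map_comap_eq_self hle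
    exact ⟨⟨L.comap i, by rw [← hexp, hm, hL]⟩, Subtype.ext hm⟩

lemma sum_exponent_eq {M : Type*} [AddCommMonoid M] (n : ℕ) [NeZero n]
    [Fintype (AddSubgroup (ZMod n × ZMod n))] (F : ℕ → M) :
    ∑ H : AddSubgroup (ZMod n × ZMod n), F (AddMonoid.exponent H)
      = ∑ e ∈ n.divisors, fullExponentCount e • F e := by
  classical
  have hmaps : ∀ H ∈ (Finset.univ : Finset (AddSubgroup (ZMod n × ZMod n))),
      AddMonoid.exponent H ∈ n.divisors := by
    intro H _
    refine Nat.mem_divisors.2 ⟨AddMonoid.exponent_dvd_iff_forall_nsmul_eq_zero.2 ?_, NeZero.ne n⟩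
    rintro ⟨⟨x, y⟩, h⟩
    ext <;> simp
  rw [← Finset.sum_fiberwise_of_maps_to hmaps]
  refine Finset.sum_congr rfl fun e he => ?_
  rw [Finset.sum_congr rfl (g := fun _ => F e)
    (fun H hH => by rw [(Finset.mem_filter.1 hH).2]), Finset.sum_const,
    ← card_exponent_eq (Nat.dvd_of_mem_divisors he), Nat.card_eq_fintype_card,
    Fintype.card_subtype]

lemma subgroupCount_eq_sum_fullExponentCount (n : ℕ) [NeZero n] :
    subgroupCount n = ∑ e ∈ n.divisors, fullExponentCount e := by
  have : Fintype (AddSubgroup (ZMod n × ZMod n)) := Fintype.ofFinite _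
  have := sum_exponent_eq n (fun _ => 1)
  simpa [subgroupCount, Nat.card_eq_fintype_card] using this

lemma finsum_exponent_eq (n : ℕ) [NeZero n] :
    (∑ᶠ H : AddSubgroup (ZMod n × ZMod n), (AddMonoid.exponent H : ℝ))
      = ∑ e ∈ n.divisors, (fullExponentCount e : ℝ) * e := by
  have : Fintype (AddSubgroup (ZMod n × ZMod n)) := Fintype.ofFinite _
  have := sum_exponent_eq n (fun e => (e : ℝ))
  rw [finsum_eq_sum_of_fintype, this]
  simp

/-! ### Multiplicativity and values at prime powers -/

open ArithmeticFunction ArithmeticFunction.zeta ArithmeticFunction.sigma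
  ArithmeticFunction.Moebius

/-- `n ↦ s(n)` as an arithmetic function (hence with value `0` at `0`). -/
noncomputable def subgroupCountFun : ArithmeticFunction ℝ :=
  ⟨fun n => if n = 0 then 0 else subgroupCount n, by simp⟩

/-- `e ↦` the number of subgroups of `ℤ_e × ℤ_e` of exponent `e`, as an arithmetic function. -/
noncomputable def fullExponentFun : ArithmeticFunction ℝ :=
  ⟨fun n => if n = 0 then 0 else fullExponentCount n, by simp⟩

/-- Euler's totient as an arithmetic function. -/
def totientFun : ArithmeticFunction ℕ := ⟨Nat.totient, Nat.totient_zero⟩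

/-- The real-valued identity `n ↦ n` as an arithmetic function. -/
noncomputable def idFun : ArithmeticFunction ℝ :=
  ((ArithmeticFunction.id : ArithmeticFunction ℕ) : ArithmeticFunction ℝ)

@[simp] lemma idFun_apply (n : ℕ) : idFun n = n := by simp [idFun]

lemma isMultiplicative_idFun : idFun.IsMultiplicative := isMultiplicative_id.natCast

lemma isMultiplicative_totientFun : totientFun.IsMultiplicative :=
  ⟨Nat.totient_one, fun h => Nat.totient_mul h⟩

lemma subgroupCountFun_apply {n : ℕ} (hn : n ≠ 0) : subgroupCountFun n = subgroupCount n :=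
  if_neg hn

lemma fullExponentFun_apply {n : ℕ} (hn : n ≠ 0) : fullExponentFun n = fullExponentCount n :=
  if_neg hn

/-- From `gcd (a, b) = ∑ φ(d)` over the common divisors `d` of `a` and `b`. -/
lemma sum_gcd_eq_totient_mul (n : ℕ) :
    ∑ a ∈ n.divisors, ∑ b ∈ n.divisors, a.gcd b = (totientFun * (σ 0).pmul (σ 0)) n := by
  rcases eq_or_ne n 0 with rfl | hn
  · simp
  have hg : ∀ a ∈ n.divisors, ∀ b ∈ n.divisors,
      a.gcd b = ∑ d ∈ n.divisors, if d ∣ a ∧ d ∣ b then d.totient else 0 := by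
    intro a ha b hb
    have ha' := Nat.dvd_of_mem_divisors ha
    have h0 : a ≠ 0 := (Nat.pos_of_mem_divisors ha).ne'
    rw [← Finset.sum_filter]
    nth_rw 1 [← Nat.sum_totient (a.gcd b)]
    refine Finset.sum_congr ?_ fun _ _ => rfl
    ext d
    simp only [Nat.mem_divisors, Finset.mem_filter, Nat.dvd_gcd_iff, ne_eq, Nat.gcd_eq_zero_iff]
    constructor
    · rintro ⟨h, -⟩
      exact ⟨⟨h.1.trans ha', hn⟩, h⟩
    · rintro ⟨-, h⟩
      exact ⟨h, fun h => h0 h.1⟩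
  have hcount : ∀ d ∈ n.divisors, (n.divisors.filter (d ∣ ·)).card = (n / d).divisors.card := by
    intro d hd
    have hd' := Nat.dvd_of_mem_divisors hd
    have hpos := Nat.pos_of_mem_divisors hd
    refine Finset.card_bij' (fun a _ => a / d) (fun b _ => d * b) ?_ ?_ ?_ ?_
    · intro a ha
      simp only [Finset.mem_filter, Nat.mem_divisors] at ha ⊢
      exact ⟨Nat.div_dvd_div ha.2 ha.1.1,
        (Nat.div_pos (Nat.le_of_dvd (Nat.pos_of_ne_zero hn) hd') hpos).ne'⟩
    · intro b hb
      simp only [Finset.mem_filter, Nat.mem_divisors] at hb ⊢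
      refine ⟨⟨?_, hn⟩, Dvd.intro _ rfl⟩
      have := Nat.mul_dvd_mul_left d hb.1
      rwa [Nat.mul_div_cancel' hd'] at this
    · intro a ha
      exact Nat.mul_div_cancel' (Finset.mem_filter.1 ha).2
    · intro b _
      exact Nat.mul_div_cancel_left _ hpos
  rw [Finset.sum_congr rfl fun a ha => Finset.sum_congr rfl fun b hb => hg a ha b hb]
  rw [Finset.sum_congr rfl fun a _ => Finset.sum_comm]
  rw [Finset.sum_comm, mul_apply,
    Nat.sum_divisorsAntidiagonal fun i j => totientFun i * ((σ 0).pmul (σ 0)) j]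
  refine Finset.sum_congr rfl fun d hd => ?_
  rw [pmul_apply, sigma_zero_apply, ← hcount d hd]
  simp only [ite_and, totientFun, coe_mk, Finset.card_filter]
  rw [Finset.sum_mul_sum, Finset.mul_sum]
  refine Finset.sum_congr rfl fun a _ => ?_
  rw [Finset.mul_sum]
  refine Finset.sum_congr rfl fun b _ => ?_
  split_ifs <;> simp

/-- `s = φ * τ ^ 2`, as Dirichlet convolution. -/
lemma subgroupCountFun_eq :
    subgroupCountFun =
      ((totientFun * (σ 0).pmul (σ 0) : ArithmeticFunction ℕ) : ArithmeticFunction ℝ) := by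
  ext n
  rcases eq_or_ne n 0 with rfl | hn
  · simp
  have : NeZero n := ⟨hn⟩
  rw [subgroupCountFun_apply hn, subgroupCount_eq_sum_gcd, sum_gcd_eq_totient_mul, natCoe_apply]

lemma isMultiplicative_subgroupCountFun : subgroupCountFun.IsMultiplicative := by
  rw [subgroupCountFun_eq]
  exact (isMultiplicative_totientFun.mul
    (isMultiplicative_sigma.pmul isMultiplicative_sigma)).natCast

lemma subgroupCountFun_eq_zeta_mul : subgroupCountFun = ζ * fullExponentFun := by
  ext n
  rcases eq_or_ne n 0 with rfl | hn
  · simp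
  have : NeZero n := ⟨hn⟩
  rw [coe_zeta_mul_apply, subgroupCountFun_apply hn, subgroupCount_eq_sum_fullExponentCount]
  push_cast
  exact Finset.sum_congr rfl fun d hd =>
    (fullExponentFun_apply (Nat.pos_of_mem_divisors hd).ne').symm

lemma isMultiplicative_fullExponentFun : fullExponentFun.IsMultiplicative := by
  have : fullExponentFun =
      ((μ : ArithmeticFunction ℤ) : ArithmeticFunction ℝ) * subgroupCountFun := by
    rw [subgroupCountFun_eq_zeta_mul, ← mul_assoc, coe_moebius_mul_coe_zeta, one_mul]
  rw [this]
  exact isMultiplicative_moebius.intCast.mul isMultiplicative_subgroupCountFun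

/-- In `s(p ^ (k + 1)) = ∑ gcd (a, b)`, the pairs of divisors of `p ^ (k + 1)` that are not
pairs of divisors of `p ^ k` are those with an entry `p ^ (k + 1)`. -/
lemma subgroupCountFun_prime_pow_succ {p : ℕ} (hp : p.Prime) (k : ℕ) :
    subgroupCountFun (p ^ (k + 1))
      = subgroupCountFun (p ^ k) + 2 * ∑ i ∈ Finset.range (k + 1), (p : ℝ) ^ i
        + (p : ℝ) ^ (k + 1) := by
  have h : ∀ k, subgroupCountFun (p ^ k)
      = ∑ i ∈ Finset.range (k + 1), ∑ j ∈ Finset.range (k + 1),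
          (((p ^ i).gcd (p ^ j) : ℕ) : ℝ) := by
    intro k
    have h0 : p ^ k ≠ 0 := pow_ne_zero _ hp.ne_zero
    have : NeZero (p ^ k) := ⟨h0⟩
    rw [subgroupCountFun_apply h0, subgroupCount_eq_sum_gcd]
    simp only [Nat.sum_divisors_prime_pow hp]
    push_cast
    rfl
  rw [h, h, Finset.sum_range_succ _ (k + 1), Finset.sum_range_succ _ (k + 1)]
  simp_rw [Finset.sum_range_succ _ (k + 1)]
  rw [Finset.sum_add_distrib, Nat.gcd_self]
  have h1 : ∀ i ∈ Finset.range (k + 1), (p ^ i).gcd (p ^ (k + 1)) = p ^ i := fun i hi =>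
    Nat.gcd_eq_left (pow_dvd_pow p (Finset.mem_range.1 hi).le)
  rw [Finset.sum_congr rfl fun i hi => congrArg Nat.cast (h1 i hi),
    Finset.sum_congr rfl fun i hi => congrArg Nat.cast ((Nat.gcd_comm _ _).trans (h1 i hi))]
  push_cast
  ring

lemma subgroupCountFun_one : subgroupCountFun 1 = 1 := isMultiplicative_subgroupCountFun.map_one

lemma fullExponentFun_prime_pow_succ {p : ℕ} (hp : p.Prime) (k : ℕ) :
    fullExponentFun (p ^ (k + 1)) = 2 * ∑ i ∈ Finset.range (k + 1), (p : ℝ) ^ i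
        + (p : ℝ) ^ (k + 1) := by
  have h : ∀ k, subgroupCountFun (p ^ k) = ∑ i ∈ Finset.range (k + 1), fullExponentFun (p ^ i) := by
    intro k
    rw [subgroupCountFun_eq_zeta_mul, coe_zeta_mul_apply, Nat.sum_divisors_prime_pow hp]
  have := subgroupCountFun_prime_pow_succ hp k
  rw [h (k + 1), Finset.sum_range_succ, ← h] at this
  linarith

/-- The sum of the exponents of the subgroups of `ℤ_n × ℤ_n` is `σ(n) ^ 2`. -/
lemma zeta_mul_pmul_fullExponentFun :
    ζ * idFun.pmul fullExponentFun
      = ((((σ 1).pmul (σ 1) : ArithmeticFunction ℕ)) : ArithmeticFunction ℝ) := by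
  rw [(IsMultiplicative.mul isMultiplicative_zeta.natCast
    (isMultiplicative_idFun.pmul isMultiplicative_fullExponentFun)).eq_iff_eq_on_prime_powers _ _
    (isMultiplicative_sigma.pmul isMultiplicative_sigma).natCast]
  intro p k hp
  rw [coe_zeta_mul_apply, Nat.sum_divisors_prime_pow hp, natCoe_apply, pmul_apply,
    sigma_one_apply_prime_pow hp]
  push_cast
  induction k with
  | zero => simp [isMultiplicative_fullExponentFun.map_one]
  | succ k ih =>
    rw [Finset.sum_range_succ, ih, pmul_apply, fullExponentFun_prime_pow_succ hp,
      Finset.sum_range_succ _ (k + 1), idFun_apply]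
    push_cast
    ring

/-- The mean exponent as an arithmetic function, in the form `σ ^ 2 / s`; by `meanExponentFun_apply`
it agrees with `meanExponent` at positive integers. -/
noncomputable def meanExponentFun : ArithmeticFunction ℝ :=
  pdiv (((σ 1).pmul (σ 1) : ArithmeticFunction ℕ) : ArithmeticFunction ℝ) subgroupCountFun

lemma isMultiplicative_meanExponentFun : meanExponentFun.IsMultiplicative :=
  (isMultiplicative_sigma.pmul isMultiplicative_sigma).natCast.pdiv isMultiplicative_subgroupCountFun

lemma meanExponent_eq {n : ℕ} (hn : n ≠ 0) :
    meanExponent n = ((∑ d ∈ n.divisors, d : ℕ) : ℝ) ^ 2 / (subgroupCount n : ℝ) := by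
  have : NeZero n := ⟨hn⟩
  have h := congrArg (fun f => f n) zeta_mul_pmul_fullExponentFun
  simp only [coe_zeta_mul_apply, natCoe_apply, pmul_apply, sigma_one_apply, idFun_apply] at h
  rw [meanExponent, finsum_exponent_eq, sq]
  push_cast at h ⊢
  rw [← h]
  congr 1
  refine Finset.sum_congr rfl fun d hd => ?_
  rw [fullExponentFun_apply (Nat.pos_of_mem_divisors hd).ne', mul_comm]

lemma meanExponentFun_apply {n : ℕ} (hn : n ≠ 0) : meanExponentFun n = meanExponent n := by
  rw [meanExponent_eq hn, meanExponentFun, pdiv_apply, natCoe_apply, pmul_apply, sigma_one_apply,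
    subgroupCountFun_apply hn]
  push_cast
  rw [sq]

/-- The closed form of `s(p ^ k)`. -/
lemma subgroupCountFun_prime_pow {p : ℕ} (hp : p.Prime) (k : ℕ) :
    ((p : ℝ) - 1) ^ 2 * subgroupCountFun (p ^ k)
      = (p : ℝ) ^ (k + 2) + (p : ℝ) ^ (k + 1) - (2 * (k : ℝ) + 3) * p + 2 * k + 1 := by
  induction k with
  | zero => rw [pow_zero, subgroupCountFun_one]; push_cast; ring
  | succ k ih =>
    have hs := mul_geom_sum (p : ℝ) (k + 1)
    rw [subgroupCountFun_prime_pow_succ hp, mul_add, mul_add, ih]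
    push_cast
    linear_combination 2 * ((p : ℝ) - 1) * hs

lemma subgroupCountFun_pos {n : ℕ} (hn : n ≠ 0) : 0 < subgroupCountFun n := by
  have : NeZero n := ⟨hn⟩
  rw [subgroupCountFun_apply hn, subgroupCount]
  exact_mod_cast Nat.card_pos

lemma meanExponentFun_prime_pow {p : ℕ} (hp : p.Prime) (k : ℕ) :
    meanExponentFun (p ^ k) = ((p : ℝ) ^ (k + 1) - 1) ^ 2 /
      ((p : ℝ) ^ (k + 2) + (p : ℝ) ^ (k + 1) - (2 * (k : ℝ) + 3) * p + 2 * k + 1) := by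
  have h1 : ((p : ℝ) - 1) ^ 2 ≠ 0 :=
    pow_ne_zero _ (sub_ne_zero.2 (by exact_mod_cast hp.one_lt.ne'))
  have hs := mul_geom_sum (p : ℝ) (k + 1)
  rw [← subgroupCountFun_prime_pow hp, meanExponentFun, pdiv_apply, natCoe_apply, pmul_apply,
    sigma_one_apply_prime_pow hp, ← hs, ← mul_div_mul_left _ _ h1]
  push_cast
  ring

/-! ### The correction factor `g` with `A = id * g` -/

lemma idFun_pmul_mul (f g : ArithmeticFunction ℝ) :
    idFun.pmul (f * g) = idFun.pmul f * idFun.pmul g := by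
  ext n
  simp only [pmul_apply, mul_apply, Finset.mul_sum, idFun_apply]
  refine Finset.sum_congr rfl fun x hx => ?_
  rw [← (Nat.mem_divisorsAntidiagonal.1 hx).1]
  push_cast
  ring

/-- The Dirichlet convolution quotient of the mean exponent by the identity. -/
noncomputable def correctionFun : ArithmeticFunction ℝ :=
  idFun.pmul ((μ : ArithmeticFunction ℤ) : ArithmeticFunction ℝ) * meanExponentFun

lemma idFun_mul_correctionFun : idFun * correctionFun = meanExponentFun := by
  have h : idFun * idFun.pmul ((μ : ArithmeticFunction ℤ) : ArithmeticFunction ℝ) = 1 := by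
    nth_rw 1 [← pmul_zeta idFun]
    rw [← idFun_pmul_mul, coe_zeta_mul_coe_moebius]
    ext n
    rcases eq_or_ne n 1 with rfl | hn
    · simp
    · simp [one_apply_ne hn]
  rw [correctionFun, ← mul_assoc, h, one_mul]

lemma isMultiplicative_correctionFun : correctionFun.IsMultiplicative :=
  (isMultiplicative_idFun.pmul isMultiplicative_moebius.intCast).mul
    isMultiplicative_meanExponentFun

lemma mul_apply_prime_pow {R : Type*} [Semiring R] (f g : ArithmeticFunction R) {p : ℕ}
    (hp : p.Prime) (k : ℕ) :
    (f * g) (p ^ k) = ∑ i ∈ Finset.range (k + 1), f (p ^ i) * g (p ^ (k - i)) := by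
  rw [mul_apply, Nat.sum_divisorsAntidiagonal fun i j => f i * g j, Nat.sum_divisors_prime_pow hp]
  refine Finset.sum_congr rfl fun i hi => ?_
  rw [Nat.pow_div (by simpa [Nat.lt_succ_iff] using hi) hp.pos]

lemma correctionFun_prime_pow_succ {p : ℕ} (hp : p.Prime) (k : ℕ) :
    correctionFun (p ^ (k + 1)) = meanExponentFun (p ^ (k + 1)) - p * meanExponentFun (p ^ k) := by
  rw [← idFun_mul_correctionFun, mul_apply_prime_pow _ _ hp, mul_apply_prime_pow _ _ hp,
    Finset.sum_range_succ', Finset.mul_sum, eq_sub_iff_add_eq, add_comm]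
  simp only [idFun_apply, Nat.add_sub_add_right]
  congr 1
  · refine Finset.sum_congr rfl fun i _ => ?_
    push_cast
    ring
  · simp

/-- A lower bound for `(p - 1) ^ 2 * s(p ^ k)`. -/
lemma half_mul_le_count_prime_pow {p : ℝ} (hp : 2 ≤ p) {k : ℕ} (hk : 1 ≤ k) :
    p ^ 2 * p ^ k / 2 ≤ p ^ (k + 2) + p ^ (k + 1) - (2 * (k : ℝ) + 3) * p + 2 * k + 1 := by
  rcases hk.eq_or_lt with rfl | hk
  · norm_num
    nlinarith [mul_nonneg (sub_nonneg.2 hp) (sub_nonneg.2 hp), pow_two_nonneg p,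
      mul_nonneg (sub_nonneg.2 hp) (mul_nonneg (sub_nonneg.2 hp) (sub_nonneg.2 hp))]
  · have h2 : ∀ j : ℕ, 2 * ((j + 2 : ℕ) : ℝ) + 3 ≤ 2 * p ^ (j + 2) := by
      intro j
      induction j with
      | zero => norm_num; nlinarith
      | succ j ih =>
        have : (1 : ℝ) ≤ p ^ (j + 2) := one_le_pow₀ (by linarith)
        rw [show j + 1 + 2 = (j + 2) + 1 from rfl, pow_succ]
        push_cast at ih ⊢
        nlinarith
    obtain ⟨j, rfl⟩ : ∃ j, k = j + 2 := ⟨k - 2, by omega⟩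
    have h3 := h2 j
    have h4 : (0 : ℝ) < p ^ (j + 2) := by positivity
    set q := p ^ (j + 2)
    set c : ℝ := ((j + 2 : ℕ) : ℝ)
    have hc : 0 ≤ c := Nat.cast_nonneg _
    have e1 : p ^ (j + 2 + 2) = q * p ^ 2 := pow_add _ _ _
    have e2 : p ^ (j + 2 + 1) = q * p := pow_succ _ _
    rw [e1, e2]
    -- the bound is `(2 k + 3) p ≤ 2 q p` together with `q p ≤ p ^ 2 q / 2`
    nlinarith [mul_nonneg (sub_nonneg.2 h3) (by linarith : (0 : ℝ) ≤ p),
      mul_nonneg (mul_nonneg h4.le (by linarith : (0 : ℝ) ≤ p)) (sub_nonneg.2 hp)]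

/-- The mean exponent at `p ^ k` exceeds `p ^ (k + 1) / (p + 1)` by at most
`(k + 2) (k + 3) / (2 p)`. -/
lemma meanExponentFun_prime_pow_sub {p : ℕ} (hp : p.Prime) (k : ℕ) :
    0 ≤ p * (meanExponentFun (p ^ k) - (p : ℝ) ^ (k + 1) / (p + 1)) ∧
    p * (meanExponentFun (p ^ k) - (p : ℝ) ^ (k + 1) / (p + 1)) ≤ ((k : ℝ) + 2) * (k + 3) / 2 := by
  have hp2 : (2 : ℝ) ≤ p := by exact_mod_cast hp.two_le
  have hp1 : (0 : ℝ) < p + 1 := by linarith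
  rcases Nat.eq_zero_or_pos k with rfl | hk
  · rw [pow_zero, isMultiplicative_meanExponentFun.map_one]
    have : (p : ℝ) * (1 - (p : ℝ) ^ (0 + 1) / (p + 1)) = p / (p + 1) := by field_simp; ring
    rw [this]
    refine ⟨by positivity, ?_⟩
    rw [div_le_iff₀ hp1]
    norm_num
    linarith
  · rw [meanExponentFun_prime_pow hp]
    have hD := half_mul_le_count_prime_pow hp2 hk
    have hk1 : (1 : ℝ) ≤ k := by exact_mod_cast hk
    have e1 : (p : ℝ) ^ (k + 2) = p ^ 2 * p ^ k := by ring
    have e2 : (p : ℝ) ^ (k + 1) = p * p ^ k := by ring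
    rw [e1, e2] at hD ⊢
    clear e1 e2
    -- no integer lies strictly between `1` and `2`
    have hk2 : 0 ≤ ((k : ℝ) - 1) * (k - 2) := by
      rcases Nat.eq_or_lt_of_le (Nat.succ_le_of_lt hk) with rfl | hk
      · norm_num
      · have : (2 : ℝ) ≤ k := by exact_mod_cast hk
        exact mul_nonneg (by linarith) (by linarith)
    have hq : (1 : ℝ) ≤ (p : ℝ) ^ k := one_le_pow₀ (by linarith)
    generalize (p : ℝ) ^ k = q at *
    generalize (p : ℝ) = r at *
    generalize (k : ℝ) = c at *
    generalize hDD : r ^ 2 * q + r * q - (2 * c + 3) * r + 2 * c + 1 = D at *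
    have hD0 : 0 < D := lt_of_lt_of_le (by positivity) hD
    have key : r * ((r * q - 1) ^ 2 / D - r * q / (r + 1))
        = r * (r * q * ((2 * c + 1) * r - (2 * c + 3)) + r + 1) / ((r + 1) * D) := by
      rw [div_sub_div _ _ hD0.ne' hp1.ne', mul_div_assoc, mul_comm D (r + 1)]
      congr 2
      rw [← hDD]
      ring
    have hrq : 0 < r * q := by positivity
    rw [key]
    refine ⟨div_nonneg (mul_nonneg (by linarith) ?_) (by positivity), ?_⟩
    · have : 0 ≤ (2 * c + 1) * r - (2 * c + 3) := by nlinarith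
      have := mul_nonneg hrq.le this
      linarith
    · rw [div_le_iff₀ (by positivity)]
      calc r * (r * q * ((2 * c + 1) * r - (2 * c + 3)) + r + 1)
          ≤ r * ((2 * c + 1) * (r ^ 2 * q)) := by
            refine mul_le_mul_of_nonneg_left ?_ (by linarith)
            nlinarith [mul_nonneg (by linarith : 0 ≤ r) (sub_nonneg.2 hq),
              mul_nonneg hrq.le (by linarith : 0 ≤ c)]
        _ ≤ r * ((2 * c + 1) * (2 * D)) := by
            refine mul_le_mul_of_nonneg_left ?_ (by linarith)
            exact mul_le_mul_of_nonneg_left (by linarith) (by linarith)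
        _ ≤ (r + 1) * ((2 * c + 1) * (2 * D)) :=
            mul_le_mul_of_nonneg_right (by linarith) (by positivity)
        _ ≤ (c + 2) * (c + 3) / 2 * ((r + 1) * D) := by
            have hkk : 2 * (2 * c + 1) ≤ (c + 2) * (c + 3) / 2 := by linarith
            nlinarith [mul_le_mul_of_nonneg_right hkk (by positivity : 0 ≤ (r + 1) * D)]

/-- The number of ordered factorizations of `n` into three factors. -/
noncomputable def tripleDivisorFun : ArithmeticFunction ℝ := ζ * ζ * ζ

lemma isMultiplicative_tripleDivisorFun : tripleDivisorFun.IsMultiplicative :=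
  (isMultiplicative_zeta.natCast.mul isMultiplicative_zeta.natCast).mul
    isMultiplicative_zeta.natCast

lemma tripleDivisorFun_prime_pow {p : ℕ} (hp : p.Prime) (k : ℕ) :
    tripleDivisorFun (p ^ k) = ((k : ℝ) + 1) * (k + 2) / 2 := by
  have h2 : ∀ k : ℕ, ((ζ : ArithmeticFunction ℝ) * ζ) (p ^ k) = (k : ℝ) + 1 := by
    intro k
    rw [coe_zeta_mul_apply, Nat.sum_divisors_prime_pow hp]
    simp [natCoe_apply, zeta_apply, hp.ne_zero]
  rw [tripleDivisorFun, coe_mul_zeta_apply, Nat.sum_divisors_prime_pow hp]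
  simp_rw [h2]
  induction k with
  | zero => norm_num
  | succ k ih =>
    rw [Finset.sum_range_succ, ih]
    push_cast
    ring

/-- Both `A(p ^ (k + 1))` and `p A(p ^ k)` exceed `p ^ (k + 2) / (p + 1)` by at most
`(k + 2) (k + 3) / 2`, so they differ by at most that. -/
lemma abs_correctionFun_prime_pow_le {p : ℕ} (hp : p.Prime) (k : ℕ) :
    |correctionFun (p ^ k)| ≤ tripleDivisorFun (p ^ k) := by
  rw [tripleDivisorFun_prime_pow hp]
  rcases k with _ | k
  · rw [pow_zero, isMultiplicative_correctionFun.map_one]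
    norm_num
  · obtain ⟨h1, h2⟩ := meanExponentFun_prime_pow_sub hp k
    obtain ⟨h3, h4⟩ := meanExponentFun_prime_pow_sub hp (k + 1)
    have hp2 : (2 : ℝ) ≤ p := by exact_mod_cast hp.two_le
    rw [correctionFun_prime_pow_succ hp]
    have e : (p : ℝ) ^ (k + 1 + 1) / (p + 1) = p * ((p : ℝ) ^ (k + 1) / (p + 1)) := by ring
    rw [e] at h3 h4
    generalize (p : ℝ) ^ (k + 1) / (p + 1) = m at *
    generalize meanExponentFun (p ^ (k + 1)) = a at *
    generalize meanExponentFun (p ^ k) = b at *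
    have hk0 : (0 : ℝ) ≤ k := Nat.cast_nonneg k
    generalize (p : ℝ) = r at *
    push_cast at h3 h4 ⊢
    have h5 : 0 ≤ a - r * m := nonneg_of_mul_nonneg_right h3 (by linarith)
    have h6 : 2 * (a - r * m) ≤ r * (a - r * m) := mul_le_mul_of_nonneg_right hp2 h5
    rw [abs_le]
    constructor <;> nlinarith

lemma abs_correctionFun_le (n : ℕ) : |correctionFun n| ≤ tripleDivisorFun n := by
  rcases eq_or_ne n 0 with rfl | hn
  · simp
  rw [isMultiplicative_correctionFun.multiplicative_factorization _ hn,
    isMultiplicative_tripleDivisorFun.multiplicative_factorization _ hn,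
    Finsupp.prod, Finsupp.prod, Finset.abs_prod]
  exact Finset.prod_le_prod (fun _ _ => abs_nonneg _) fun p hp =>
    abs_correctionFun_prime_pow_le (Nat.prime_of_mem_primeFactors hp) _

lemma meanExponentFun_nonneg (n : ℕ) : 0 ≤ meanExponentFun n := by
  rcases eq_or_ne n 0 with rfl | hn
  · simp
  rw [meanExponentFun, pdiv_apply, natCoe_apply]
  exact div_nonneg (Nat.cast_nonneg _) (subgroupCountFun_pos hn).le

lemma meanExponentFun_le {n : ℕ} (hn : n ≠ 0) : meanExponentFun n ≤ n := by
  rw [meanExponentFun, pdiv_apply, div_le_iff₀ (subgroupCountFun_pos hn),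
    ← zeta_mul_pmul_fullExponentFun, subgroupCountFun_eq_zeta_mul, coe_zeta_mul_apply,
    coe_zeta_mul_apply, Finset.mul_sum]
  refine Finset.sum_le_sum fun d hd => ?_
  rw [pmul_apply, idFun_apply, fullExponentFun_apply (Nat.pos_of_mem_divisors hd).ne']
  exact mul_le_mul_of_nonneg_right (by exact_mod_cast Nat.divisor_le hd) (Nat.cast_nonneg _)

/-! ### The local factors -/

lemma eulerTerm_eq {p : ℕ} (hp : p.Prime) (k : ℕ) :
    eulerTerm p k = meanExponentFun (p ^ k) / (p : ℝ) ^ (2 * k) := by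
  rw [meanExponentFun_prime_pow hp, eulerTerm, div_div, mul_comm]

lemma summable_eulerTerm {p : ℕ} (hp : p.Prime) : Summable (fun k : ℕ => eulerTerm p k) := by
  have hp2 : (2 : ℝ) ≤ p := by exact_mod_cast hp.two_le
  refine Summable.of_nonneg_of_le (fun k => ?_) (fun k => ?_)
    (summable_geometric_of_lt_one (r := 1 / (p : ℝ)) (by positivity)
      (by rw [div_lt_one (by linarith)]; linarith))
  · rw [eulerTerm_eq hp]
    exact div_nonneg (meanExponentFun_nonneg _) (by positivity)
  · rw [eulerTerm_eq hp, div_le_iff₀ (by positivity), two_mul, pow_add, ← mul_assoc, ← mul_pow,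
      one_div, inv_mul_cancel₀ (by linarith), one_pow, one_mul]
    exact_mod_cast meanExponentFun_le (pow_ne_zero k hp.ne_zero)

/-- The factor `1 - 1 / p` turns the local series of `A` into that of `g`. -/
lemma hasSum_correctionFun_prime_pow {p : ℕ} (hp : p.Prime) :
    HasSum (fun k : ℕ => correctionFun (p ^ k) / ((p ^ k : ℕ) : ℝ) ^ 2) (eulerFactor p) := by
  have hp0 : (p : ℝ) ≠ 0 := by exact_mod_cast hp.ne_zero
  have hs := (summable_eulerTerm hp).hasSum
  rw [← hasSum_nat_add_iff' 1]
  have h1 := ((hasSum_nat_add_iff' 1).2 hs).sub (hs.mul_left (1 / (p : ℝ)))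
  convert h1 using 1
  · ext k
    rw [correctionFun_prime_pow_succ hp, eulerTerm_eq hp, eulerTerm_eq hp]
    push_cast
    field_simp
    ring
  · simp [eulerFactor, eulerTerm_eq hp, isMultiplicative_correctionFun.map_one,
      isMultiplicative_meanExponentFun.map_one]
    ring

/-! ### Dirichlet series at real points -/

lemma lSeriesHasSum_ofReal_iff (f : ArithmeticFunction ℝ) (s a : ℝ) :
    LSeriesHasSum (fun n => ((f n : ℝ) : ℂ)) s a ↔ HasSum (fun n : ℕ => f n / (n : ℝ) ^ s) a := by
  rw [LSeriesHasSum, ← Complex.hasSum_ofReal]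
  suffices h : LSeries.term (fun n => ((f n : ℝ) : ℂ)) s
      = fun n : ℕ => ((f n / (n : ℝ) ^ s : ℝ) : ℂ) by rw [h]
  ext n
  rcases eq_or_ne n 0 with rfl | hn
  · simp
  · rw [LSeries.term_of_ne_zero hn, Complex.ofReal_div, Complex.ofReal_cpow (Nat.cast_nonneg n)]
    simp

lemma hasSum_mul_div_rpow {f g : ArithmeticFunction ℝ} {s a b : ℝ}
    (hf : HasSum (fun n : ℕ => f n / (n : ℝ) ^ s) a)
    (hg : HasSum (fun n : ℕ => g n / (n : ℝ) ^ s) b) :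
    HasSum (fun n : ℕ => (f * g) n / (n : ℝ) ^ s) (a * b) := by
  rw [← lSeriesHasSum_ofReal_iff] at hf hg ⊢
  have := hf.convolution hg
  rw [← Complex.ofReal_mul] at this
  convert this using 1
  ext n
  rw [LSeries.convolution_def, mul_apply]
  push_cast
  rfl

/-- The series of `ζ(s)` converges to a value at most `1 + 1 / (s - 1)`. -/
lemma exists_hasSum_zeta_div_rpow {s : ℝ} (hs : 1 < s) :
    ∃ z, 0 ≤ z ∧ z ≤ 1 + 1 / (s - 1) ∧
      HasSum (fun n : ℕ => (ζ : ArithmeticFunction ℝ) n / (n : ℝ) ^ s) z := by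
  have hsum : Summable (fun n : ℕ => 1 / ((n : ℝ) + 1) ^ s) := by
    have := (summable_nat_add_iff 1).2 (Real.summable_one_div_nat_rpow.2 hs)
    simpa using this
  refine ⟨∑' n : ℕ, 1 / (n + 1 : ℝ) ^ s, tsum_nonneg fun n => by positivity, ?_, ?_⟩
  · have h1 := ZetaAsymptotics.zeta_limit_aux1 hs
    have h2 : 0 ≤ s * ZetaAsymptotics.termTSum s :=
      mul_nonneg (by linarith) (tsum_nonneg fun n => ZetaAsymptotics.term_nonneg _ _)
    linarith
  · rw [← hasSum_nat_add_iff' 1]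
    simpa using hsum.hasSum

lemma exists_hasSum_tripleDivisorFun_div_rpow {s : ℝ} (hs : 1 < s) :
    ∃ B, B ≤ (1 + 1 / (s - 1)) ^ 3 ∧
      HasSum (fun n : ℕ => tripleDivisorFun n / (n : ℝ) ^ s) B := by
  obtain ⟨z, h0, h1, h2⟩ := exists_hasSum_zeta_div_rpow hs
  exact ⟨z * z * z, by rw [← pow_three']; exact pow_le_pow_left₀ h0 h1 3,
    hasSum_mul_div_rpow (hasSum_mul_div_rpow h2 h2) h2⟩

lemma summable_abs_correctionFun_div_rpow {s : ℝ} (hs : 1 < s) :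
    Summable (fun n : ℕ => |correctionFun n| / (n : ℝ) ^ s) := by
  obtain ⟨B, -, hB⟩ := exists_hasSum_tripleDivisorFun_div_rpow hs
  exact hB.summable.of_nonneg_of_le (fun n => by positivity)
    fun n => div_le_div_of_nonneg_right (abs_correctionFun_le n) (by positivity)

lemma tsum_abs_correctionFun_div_rpow_le {s : ℝ} (hs : 1 < s) :
    ∑' n : ℕ, |correctionFun n| / (n : ℝ) ^ s ≤ (1 + 1 / (s - 1)) ^ 3 := by
  obtain ⟨B, hB', hB⟩ := exists_hasSum_tripleDivisorFun_div_rpow hs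
  refine le_trans ?_ (hB.tsum_eq.trans_le hB')
  exact (summable_abs_correctionFun_div_rpow hs).tsum_le_tsum
    (fun n => div_le_div_of_nonneg_right (abs_correctionFun_le n) (by positivity)) hB.summable

/-! ### The constant -/

lemma summable_correctionFun_div_sq :
    Summable (fun n : ℕ => |correctionFun n / (n : ℝ) ^ 2|) := by
  refine (summable_abs_correctionFun_div_rpow (s := 2) (by norm_num)).congr fun n => ?_
  rw [abs_div, Real.rpow_two, abs_of_nonneg (sq_nonneg (n : ℝ))]

/-- The Euler product of `∑ g(n) / n ^ 2`, whose local factors are the `eulerFactor p`. -/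
lemma hasProd_eulerFactor :
    HasProd (fun p : Nat.Primes => eulerFactor p) (∑' n : ℕ, correctionFun n / (n : ℝ) ^ 2) := by
  have h := EulerProduct.eulerProduct_hasProd
    (f := fun n : ℕ => correctionFun n / (n : ℝ) ^ 2) ?_ ?_ summable_correctionFun_div_sq ?_
  · have e : (fun p : Nat.Primes => eulerFactor p) = fun p : Nat.Primes =>
        ∑' k : ℕ, correctionFun ((p : ℕ) ^ k) / (((p : ℕ) ^ k : ℕ) : ℝ) ^ 2 :=
      funext fun p => (hasSum_correctionFun_prime_pow p.2).tsum_eq.symm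
    rw [e]
    exact h
  · simp [isMultiplicative_correctionFun.map_one]
  · intro m n hmn
    rw [isMultiplicative_correctionFun.map_mul_of_coprime hmn]
    push_cast
    rw [mul_pow, mul_div_mul_comm]
  · simp

lemma meanConstant_eq : meanConstant = ∑' n : ℕ, correctionFun n / (n : ℝ) ^ 2 :=
  hasProd_eulerFactor.tprod_eq

/-! ### Summatory functions of Dirichlet convolutions -/

/-- If the summatory function of `h` is `C y ^ α + O(y ^ β)` uniformly in all `y > 0`, including
`y < 1`, then convolution with `k` multiplies main term and error by Dirichlet series of `k`:
the sum over the divisors coming from `k` need not be truncated. -/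
lemma abs_sum_mul_sub_le (k h : ArithmeticFunction ℝ) {C α β x : ℝ}
    (hh : ∀ y : ℝ, 0 < y → |∑ m ∈ Finset.Ioc 0 ⌊y⌋₊, h m - C * y ^ α| ≤ y ^ β)
    (hα : Summable (fun d : ℕ => k d / (d : ℝ) ^ α))
    (hβ : Summable (fun d : ℕ => |k d| / (d : ℝ) ^ β)) (hx : 0 < x) :
    |∑ n ∈ Finset.Ioc 0 ⌊x⌋₊, (k * h) n - C * (∑' d : ℕ, k d / (d : ℝ) ^ α) * x ^ α|
      ≤ (∑' d : ℕ, |k d| / (d : ℝ) ^ β) * x ^ β := by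
  have h1 : HasSum (fun d : ℕ => k d * ∑ m ∈ Finset.Ioc 0 ⌊x / d⌋₊, h m)
      (∑ n ∈ Finset.Ioc 0 ⌊x⌋₊, (k * h) n) := by
    rw [sum_Ioc_mul_eq_sum_sum]
    simp_rw [← Nat.floor_div_natCast]
    refine hasSum_sum_of_ne_finset_zero fun d hd => ?_
    rcases Nat.eq_zero_or_pos d with rfl | hd0
    · simp
    · have hlt : ⌊x⌋₊ < d := by
        by_contra hc
        exact hd (Finset.mem_Ioc.2 ⟨hd0, not_lt.1 hc⟩)
      rw [Nat.floor_div_natCast, Nat.div_eq_of_lt hlt]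
      simp
  have h2 := h1.sub ((hα.hasSum.mul_left C).mul_right (x ^ α))
  rw [← h2.tsum_eq, ← Real.norm_eq_abs]
  refine tsum_of_norm_bounded (hβ.hasSum.mul_right (x ^ β)) fun d => ?_
  rcases Nat.eq_zero_or_pos d with rfl | hd0
  · simp
  have hd : (0 : ℝ) < d := by exact_mod_cast hd0
  have h3 := mul_le_mul_of_nonneg_left (hh (x / d) (div_pos hx hd)) (abs_nonneg (k d))
  rw [← abs_mul, Real.div_rpow hx.le hd.le, Real.div_rpow hx.le hd.le] at h3
  rw [Real.norm_eq_abs]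
  calc _ = _ := by congr 1; ring
    _ ≤ _ := h3
    _ = _ := by ring

/-- For `y < 1` the sum is empty and `y ^ 2 / 2` is at most `y ^ β`; for `y ≥ 1` the error is at most
`y ≤ y ^ β`. -/
lemma abs_sum_idFun_sub_le {β : ℝ} (h1 : 1 ≤ β) (h2 : β ≤ 2) {y : ℝ} (hy : 0 < y) :
    |∑ m ∈ Finset.Ioc 0 ⌊y⌋₊, idFun m - 1 / 2 * y ^ (2 : ℝ)| ≤ y ^ β := by
  have hsum : ∀ N : ℕ, ∑ m ∈ Finset.Ioc 0 N, idFun m = (N : ℝ) * (N + 1) / 2 := by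
    intro N
    induction N with
    | zero => simp
    | succ N ih =>
      rw [Finset.sum_Ioc_succ_top (Nat.zero_le N), ih, idFun_apply]
      push_cast
      ring
  rw [hsum, Real.rpow_two]
  have hf := Nat.floor_le hy.le
  have hf' := Nat.lt_floor_add_one y
  rcases lt_or_ge y 1 with hy1 | hy1
  · rw [Nat.floor_eq_zero.2 hy1]
    have := Real.rpow_le_rpow_of_exponent_ge hy hy1.le h2
    rw [Real.rpow_two] at this
    rw [abs_le]
    constructor <;> push_cast <;> nlinarith
  · have := Real.rpow_le_rpow_of_exponent_le hy1 h1
    rw [Real.rpow_one] at this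
    have h0 : (0 : ℝ) ≤ (⌊y⌋₊ : ℝ) := Nat.cast_nonneg _
    generalize (⌊y⌋₊ : ℝ) = N at *
    rw [abs_le]
    constructor <;> nlinarith

lemma abs_sum_zeta_sub_le {y : ℝ} (hy : 0 < y) :
    |∑ m ∈ Finset.Ioc 0 ⌊y⌋₊, (ζ : ArithmeticFunction ℝ) m - 1 * y ^ (1 : ℝ)|
      ≤ y ^ (1 / 2 : ℝ) := by
  have hsum : ∑ m ∈ Finset.Ioc 0 ⌊y⌋₊, (ζ : ArithmeticFunction ℝ) m = ⌊y⌋₊ := by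
    simp_rw [natCoe_apply]
    exact_mod_cast sum_Ioc_zeta _
  rw [hsum, Real.rpow_one]
  have hf := Nat.floor_le hy.le
  have hf' := Nat.lt_floor_add_one y
  rcases lt_or_ge y 1 with hy1 | hy1
  · rw [Nat.floor_eq_zero.2 hy1]
    have := Real.rpow_le_rpow_of_exponent_ge hy hy1.le (by norm_num : (1 / 2 : ℝ) ≤ 1)
    rw [Real.rpow_one] at this
    rw [abs_le]
    constructor <;> push_cast <;> linarith
  · have := Real.one_le_rpow hy1 (by norm_num : (0 : ℝ) ≤ 1 / 2)
    rw [abs_le]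
    constructor <;> linarith

/-- `g(d) / d`, the convolution quotient of `A(n) / n` by the constant function `1`. -/
noncomputable def correctionDivFun : ArithmeticFunction ℝ := correctionFun.pdiv idFun

lemma correctionDivFun_mul_zeta_apply (n : ℕ) :
    (correctionDivFun * ζ) n = meanExponentFun n / n := by
  rcases eq_or_ne n 0 with rfl | hn
  · simp
  have hn0 : (n : ℝ) ≠ 0 := by exact_mod_cast hn
  rw [eq_div_iff hn0, ← idFun_mul_correctionFun, mul_comm _ (n : ℝ), ← idFun_apply, ← pmul_apply,
    idFun_pmul_mul, pmul_zeta, mul_comm]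
  congr 2
  ext d
  rcases eq_or_ne d 0 with rfl | hd
  · simp
  · rw [pmul_apply, correctionDivFun, pdiv_apply, idFun_apply, mul_div_cancel₀]
    exact_mod_cast hd

lemma correctionDivFun_div_rpow (d : ℕ) (s : ℝ) :
    correctionDivFun d / (d : ℝ) ^ s = correctionFun d / (d : ℝ) ^ (s + 1) := by
  rcases eq_or_ne d 0 with rfl | hd
  · simp
  have hd0 : (d : ℝ) ≠ 0 := by exact_mod_cast hd
  rw [correctionDivFun, pdiv_apply, idFun_apply, div_div, mul_comm, Real.rpow_add_one hd0]

lemma abs_sum_div_sub_le : ∃ B, ∀ x : ℝ, 0 < x →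
    |∑ n ∈ Finset.Icc 1 ⌊x⌋₊, meanExponent n / (n : ℝ) - meanConstant * x|
      ≤ B * x ^ (1 / 2 : ℝ) := by
  refine ⟨∑' d : ℕ, |correctionDivFun d| / (d : ℝ) ^ (1 / 2 : ℝ), fun x hx => ?_⟩
  have e : (fun d : ℕ => correctionDivFun d / (d : ℝ) ^ (1 : ℝ))
      = fun d : ℕ => correctionFun d / (d : ℝ) ^ 2 := by
    ext d
    rw [correctionDivFun_div_rpow, ← Real.rpow_two]
    norm_num
  have h := abs_sum_mul_sub_le correctionDivFun ζ (fun y hy => abs_sum_zeta_sub_le hy)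
    (e ▸ summable_correctionFun_div_sq.of_abs) ?_ hx
  · rw [e, ← meanConstant_eq, Real.rpow_one, one_mul] at h
    refine le_trans (le_of_eq ?_) h
    congr 2
    refine Finset.sum_congr rfl fun n hn => ?_
    rw [correctionDivFun_mul_zeta_apply,
      meanExponentFun_apply (Nat.one_le_iff_ne_zero.1 (Finset.mem_Icc.1 hn).1)]
  · refine (summable_abs_correctionFun_div_rpow (s := 1 / 2 + 1) (by norm_num)).congr fun d => ?_
    have hr : ∀ a s : ℝ, |a| / (d : ℝ) ^ s = |a / (d : ℝ) ^ s| := fun a s => by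
      rw [abs_div, abs_of_nonneg (a := (d : ℝ) ^ s) (by positivity)]
    rw [hr, hr, correctionDivFun_div_rpow]

lemma abs_sum_sub_le {β x : ℝ} (h1 : 1 < β) (h2 : β ≤ 2) (hx : 0 < x) :
    |∑ n ∈ Finset.Icc 1 ⌊x⌋₊, meanExponent n - meanConstant / 2 * x ^ 2|
      ≤ (1 + 1 / (β - 1)) ^ 3 * x ^ β := by
  have e : (fun d : ℕ => correctionFun d / (d : ℝ) ^ (2 : ℝ))
      = fun d : ℕ => correctionFun d / (d : ℝ) ^ 2 := by
    ext d
    rw [Real.rpow_two]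
  have h := abs_sum_mul_sub_le correctionFun idFun (fun y hy => abs_sum_idFun_sub_le h1.le h2 hy)
    (e ▸ summable_correctionFun_div_sq.of_abs) (summable_abs_correctionFun_div_rpow h1) hx
  rw [e, ← meanConstant_eq, Real.rpow_two, mul_comm correctionFun, idFun_mul_correctionFun] at h
  refine le_trans (le_of_eq ?_) (h.trans (mul_le_mul_of_nonneg_right
    (tsum_abs_correctionFun_div_rpow_le h1) (by positivity)))
  have : ∑ n ∈ Finset.Icc 1 ⌊x⌋₊, meanExponent n
      = ∑ n ∈ Finset.Ioc 0 ⌊x⌋₊, meanExponentFun n :=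
    Finset.sum_congr rfl fun n hn => (meanExponentFun_apply
      (Nat.one_le_iff_ne_zero.1 (Finset.mem_Icc.1 hn).1)).symm
  rw [this]
  congr 2
  ring

/-- Taking the exponent `1 + 1 / log x` makes `x ^ β = e x`, while the Dirichlet series grows
like the cube of `log x`. -/
lemma isBigO_sum_sub :
    (fun x : ℝ => (∑ n ∈ Finset.Icc 1 ⌊x⌋₊, meanExponent n) - meanConstant / 2 * x ^ 2)
      =O[atTop] (fun x : ℝ => x * Real.log x ^ 3) := by
  refine IsBigO.of_bound (8 * Real.exp 1) ?_
  filter_upwards [eventually_ge_atTop (Real.exp 1)] with x hx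
  have hx0 : 0 < x := (Real.exp_pos 1).trans_le hx
  have hl : 1 ≤ Real.log x := by rwa [Real.le_log_iff_exp_le hx0]
  have hl0 : 0 < Real.log x := by linarith
  have h := abs_sum_sub_le (β := 1 + 1 / Real.log x) (x := x)
    (by linarith [one_div_pos.2 hl0]) (by linarith [(div_le_one hl0).2 hl]) hx0
  have e : x ^ (1 + 1 / Real.log x) = Real.exp 1 * x := by
    rw [Real.rpow_add hx0, Real.rpow_one, Real.rpow_def_of_pos hx0, mul_one_div_cancel hl0.ne',
      mul_comm]
  rw [e, add_sub_cancel_left, one_div_one_div] at h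
  rw [Real.norm_eq_abs, Real.norm_eq_abs, abs_of_nonneg (a := x * _) (by positivity)]
  refine h.trans ?_
  have h3 : (1 + Real.log x) ^ 3 ≤ (2 * Real.log x) ^ 3 :=
    pow_le_pow_left₀ (by positivity) (by linarith) 3
  calc (1 + Real.log x) ^ 3 * (Real.exp 1 * x)
      ≤ (2 * Real.log x) ^ 3 * (Real.exp 1 * x) :=
        mul_le_mul_of_nonneg_right h3 (by positivity)
    _ = _ := by ring

lemma tendsto_mean :
    Tendsto (fun x : ℝ => (1 / x) * ∑ n ∈ Finset.Icc 1 ⌊x⌋₊, meanExponent n / (n : ℝ))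
      atTop (𝓝 meanConstant) := by
  obtain ⟨B, hB⟩ := abs_sum_div_sub_le
  rw [tendsto_iff_norm_sub_tendsto_zero]
  have h0 : Tendsto (fun x : ℝ => B * x ^ (-(1 / 2) : ℝ)) atTop (𝓝 0) := by
    simpa using (tendsto_rpow_neg_atTop (y := 1 / 2) (by norm_num)).const_mul B
  refine squeeze_zero' (Eventually.of_forall fun _ => norm_nonneg _) ?_ h0
  filter_upwards [eventually_gt_atTop 0] with x hx
  have e : (1 / x) * ∑ n ∈ Finset.Icc 1 ⌊x⌋₊, meanExponent n / (n : ℝ) - meanConstant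
      = (∑ n ∈ Finset.Icc 1 ⌊x⌋₊, meanExponent n / (n : ℝ) - meanConstant * x) / x := by
    field_simp
  have e2 : x ^ (-(1 / 2) : ℝ) = x ^ (1 / 2 : ℝ) / x := by
    rw [show (-(1 / 2) : ℝ) = 1 / 2 - 1 by norm_num, Real.rpow_sub_one hx.ne']
  rw [e, e2, Real.norm_eq_abs, abs_div, abs_of_pos hx, ← mul_div_assoc]
  exact div_le_div_of_nonneg_right (hB x hx) hx.le

theorem mainTheorem7 :
    (∀ n : ℕ, 1 ≤ n →
      meanExponent n = ((∑ d ∈ n.divisors, d : ℕ) : ℝ) ^ 2 / (subgroupCount n : ℝ)) ∧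
    (∀ p : ℕ, p.Prime → Summable (fun ν : ℕ => eulerTerm p ν)) ∧
    Multipliable (fun p : Nat.Primes => eulerFactor (p : ℕ)) ∧
    Tendsto (fun x : ℝ => (1 / x) * ∑ n ∈ Finset.Icc 1 ⌊x⌋₊, meanExponent n / (n : ℝ))
      atTop (𝓝 meanConstant) ∧
    (fun x : ℝ => (∑ n ∈ Finset.Icc 1 ⌊x⌋₊, meanExponent n) - meanConstant / 2 * x ^ 2)
      =O[atTop] (fun x : ℝ => x * Real.log x ^ 3) :=
  ⟨fun _ hn => meanExponent_eq (Nat.one_le_iff_ne_zero.1 hn), fun _ hp => summable_eulerTerm hp,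
    hasProd_eulerFactor.multipliable, tendsto_mean, isBigO_sum_sub⟩
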